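/- A $\Sigma$-CwF is a category with families (a category with a terminal object, a presheaf of types, a dependent presheaf of terms, and context extensions $\Gamma.A$) whose types are closed under $\mathbf 1$- and $\Sigma$-types, stably under substitution. A morphism of $\Sigma$-CwFs is a functor with an action on types and terms that preserves the empty context, context extensions, substitution, $\mathbf 1$ and $\Sigma$ up to canonical isomorphism. Let $\mathbf{Set}$ be the $\Sigma$-CwF of sets and families of sets, and $\mathbf{Setoid}$ the $\Sigma$-CwF of setoids, whose types over a setoid $X$ are the dependent setoids: families of sets $Y(x)$ with a dependent equivalence relation $y_1\sim y_2$ (for $y_i\in Y(x_i)$, presupposing $x_1\sim x_2$). A dependent setoid $Y$ over $X$ is *fibrant* if for all $x_1\sim x_2$ in $X$ and $y_1\in Y(x_1)$ there exists $y_2\in Y(x_2)$ with $y_1\sim y_2$. Let $\mathbf{Setoid}_{\mathsf{fib}}\subseteq\mathbf{Setoid}$ be the sub-$\Sigma$-CwF over the same base category whose types are the fibrant dependent setoids. Write $U$ for the underlying set morphism $\mathbf{Setoid}\to\mathbf{Set}$, $Q$ for the functor $X\mapsto X/{\sim}$, and $q:U\Rightarrow Q$ for the quotient maps. Let $\mathcal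 T$ be a $\Sigma$-CwF, for instance the classifying $\Sigma$-CwF of a (first-order) generalized algebraic theory. A model of $\mathcal T$ is a $\Sigma$-CwF morphism $\mathcal M:\mathcal T\to\mathbf{Set}$, and a morphism of models is a natural transformation $F$. For an object $X$ (a closed sort) it has a component $F_X:\mathcal M_X\to\mathcal N_X$, and for a type $Y$ over $X$ (a dependent sort) components $F_Y:\mathcal M_Y(x)\to\mathcal N_Y(F_X(x))$, determined by $F_{X.Y}(x,y)=(F_X(x),F_Y(y))$. A congruence over $\mathcal M$ is a $\Sigma$-CwF morphism $\widetilde{\mathcal M}:\mathcal T\to\mathbf{Setoid}$ with $U\circ\widetilde{\mathcal M}=\mathcal M$. It is fibrant if $\widetilde{\mathcal M}_Y$ is fibrant for every dependent sort $Y$, i.e. if it factors through $\mathbf{Setoid}_{\mathsf{fib}}$. We write $\widetilde{\mathcal M}\subseteq\ker_F$ if $F$ identifies all related elements of all closed and dependent sorts. A quotient of $\widetilde{\mathcal M}$ is a morphism of models $\mathbf q:\mathcal M\to\mathbf Q$ with $\widetilde{\mathcal M}\subseteq\ker_{\mathbf q}$ such that every $F:\mathcal M\to\mathcal N$ with $\widetilde{\mathcal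 M}\subseteq\ker_F$ factors uniquely through $\mathbf q$. **Theorem.** The functor $Q$ underlies a morphism of $\Sigma$-CwFs $\mathbf{Setoid}_{\mathsf{fib}}\to\mathbf{Set}$; in particular it preserves context extensions. Let $\widetilde{\mathcal M}$ be a fibrant congruence over a model $\mathcal M$ of $\mathcal T$. Then: 1. the model $\mathbf Q(\widetilde{\mathcal M})=Q\circ\widetilde{\mathcal M}$, with the quotient inclusion $\mathbf q=\widetilde{\mathcal M}\cdot q:\mathcal M\Rightarrow\mathbf Q(\widetilde{\mathcal M})$, is the quotient of $\widetilde{\mathcal M}$; 2. this quotient is computed sortwise: every $\mathbf q_X$ is surjective and identifies exactly the related elements of $\mathcal M_X$, and for every type $Y$ over $X$ the maps $\mathbf q_Y:\mathcal M_Y(x)\to\mathbf Q(\widetilde{\mathcal M})_Y(\mathbf q_X(x))$ are surjective and $\mathbf q$ identifies exactly the related elements of the sets $\mathcal M_Y(x)$; 3. $\mathbf q$ is a non-split trivial fibration: for every type $Y$ over $X$ and every $x\in\mathcal M_X$, each element of $\mathbf Q(\widetilde{\mathcal M})_Y(\mathbf q_X(x))$ has (merely) a preimage in $\mathcal M_Y(x)$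 under $\mathbf q_Y$. -/

import Mathlib

open CategoryTheory CategoryTheory.Limits

universe u u₁ v₁ w₁ t₁ u₂ v₂ w₂ t₂ u₃ v₃ w₃ t₃

/-! ## Categories with families and `Σ`-CwFs -/

/-- A category with families: a category with a terminal object, a presheaf `Ty` of types, a
dependent presheaf `Tm` of terms over it, and context extensions `Γ.A` representing the terms
of type `A` over `Γ`. -/
structure CwF where
  Ctx : Type u₁
  [cat : Category.{v₁} Ctx]
  empty : Ctx
  emptyIsTerminal : IsTerminal empty
  Ty : Ctx → Type w₁
  Tm : (Γ : Ctx) → Ty Γ → Type t₁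
  /-- `A[σ]` for a type `A`. -/
  tySub : {Δ Γ : Ctx} → (Δ ⟶ Γ) → Ty Γ → Ty Δ
  tySub_id : ∀ {Γ : Ctx} (A : Ty Γ), tySub (𝟙 Γ) A = A
  tySub_comp : ∀ {Θ Δ Γ : Ctx} (τ : Θ ⟶ Δ) (σ : Δ ⟶ Γ) (A : Ty Γ),
    tySub (τ ≫ σ) A = tySub τ (tySub σ A)
  /-- `a[σ]` for a term `a`. -/
  tmSub : {Δ Γ : Ctx} → (σ : Δ ⟶ Γ) → {A : Ty Γ} → Tm Γ A → Tm Δ (tySub σ A)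
  tmSub_id : ∀ {Γ : Ctx} {A : Ty Γ} (a : Tm Γ A), HEq (tmSub (𝟙 Γ) a) a
  tmSub_comp : ∀ {Θ Δ Γ : Ctx} (τ : Θ ⟶ Δ) (σ : Δ ⟶ Γ) {A : Ty Γ} (a : Tm Γ A),
    HEq (tmSub (τ ≫ σ) a) (tmSub τ (tmSub σ a))
  /-- The extended context `Γ.A`. -/
  ext : (Γ : Ctx) → Ty Γ → Ctx
  /-- The projection `Γ.A ⟶ Γ`. -/
  p : {Γ : Ctx} → (A : Ty Γ) → (ext Γ A ⟶ Γ)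
  /-- The generic term of type `A[p]` over `Γ.A`. -/
  q : {Γ : Ctx} → (A : Ty Γ) → Tm (ext Γ A) (tySub (p A) A)
  /-- The morphism `⟨σ, a⟩`. -/
  lift : {Δ Γ : Ctx} → (σ : Δ ⟶ Γ) → (A : Ty Γ) → Tm Δ (tySub σ A) → (Δ ⟶ ext Γ A)
  lift_p : ∀ {Δ Γ : Ctx} (σ : Δ ⟶ Γ) (A : Ty Γ) (a : Tm Δ (tySub σ A)), lift σ A a ≫ p A = σ
  lift_q : ∀ {Δ Γ : Ctx} (σ : Δ ⟶ Γ) (A : Ty Γ) (a : Tm Δ (tySub σ A)),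
    HEq (tmSub (lift σ A a) (q A)) a
  lift_uniq : ∀ {Δ Γ : Ctx} (σ : Δ ⟶ Γ) (A : Ty Γ) (a : Tm Δ (tySub σ A)) (τ : Δ ⟶ ext Γ A),
    τ ≫ p A = σ → HEq (tmSub τ (q A)) a → τ = lift σ A a

attribute [instance] CwF.cat

namespace CwF

variable (C : CwF.{u₁, v₁, w₁, t₁})

/-- The section `⟨id, a⟩ : Γ ⟶ Γ.A` of a term `a : A`. -/
def inst {Γ : C.Ctx} {A : C.Ty Γ} (a : C.Tm Γ A) : Γ ⟶ C.ext Γ A :=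
  C.lift (𝟙 Γ) A (cast (congrArg (C.Tm Γ) (C.tySub_id A).symm) a)

/-- The weakened substitution `Δ.A[σ] ⟶ Γ.A` over `σ : Δ ⟶ Γ`. -/
def up {Δ Γ : C.Ctx} (σ : Δ ⟶ Γ) (A : C.Ty Γ) : C.ext Δ (C.tySub σ A) ⟶ C.ext Γ A :=
  C.lift (C.p (C.tySub σ A) ≫ σ) A
    (cast (congrArg (C.Tm _) (C.tySub_comp _ σ A).symm) (C.q (C.tySub σ A)))

theorem up_p {Δ Γ : C.Ctx} (σ : Δ ⟶ Γ) (A : C.Ty Γ) :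
    C.up σ A ≫ C.p A = C.p (C.tySub σ A) ≫ σ :=
  C.lift_p _ _ _

theorem up_q {Δ Γ : C.Ctx} (σ : Δ ⟶ Γ) (A : C.Ty Γ) :
    HEq (C.tmSub (C.up σ A) (C.q A)) (C.q (C.tySub σ A)) :=
  (C.lift_q _ _ _).trans (cast_heq _ _)

theorem tmSub_congr {Δ Γ : C.Ctx} (σ : Δ ⟶ Γ) {A B : C.Ty Γ} (h : A = B) {a : C.Tm Γ A}
    {b : C.Tm Γ B} (hab : HEq a b) : HEq (C.tmSub σ a) (C.tmSub σ b) := by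
  subst h; cases hab; rfl

theorem hom_ext {Δ Γ : C.Ctx} {A : C.Ty Γ} {τ τ' : Δ ⟶ C.ext Γ A}
    (h : τ ≫ C.p A = τ' ≫ C.p A) (hq : HEq (C.tmSub τ (C.q A)) (C.tmSub τ' (C.q A))) :
    τ = τ' := by
  have e : C.tySub τ' (C.tySub (C.p A) A) = C.tySub (τ ≫ C.p A) A := by
    rw [h, C.tySub_comp]
  rw [C.lift_uniq (τ ≫ C.p A) A (cast (congrArg (C.Tm _) e) (C.tmSub τ' (C.q A))) τ rfl
      (hq.trans (cast_heq _ _).symm),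
    ← C.lift_uniq (τ ≫ C.p A) A (cast (congrArg (C.Tm _) e) (C.tmSub τ' (C.q A))) τ' h.symm
      (cast_heq _ _).symm]

/-- Substitution squares are pullbacks. -/
theorem isPullback_up {Δ Γ : C.Ctx} (σ : Δ ⟶ Γ) (A : C.Ty Γ) :
    IsPullback (C.up σ A) (C.p (C.tySub σ A)) (C.p A) σ := by
  refine ⟨⟨C.up_p σ A⟩, ⟨PullbackCone.IsLimit.mk (C.up_p σ A)
    (fun s => C.lift s.snd (C.tySub σ A) (cast (congrArg (C.Tm _) ?_) (C.tmSub s.fst (C.q A))))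
    ?_ ?_ ?_⟩⟩
  · rw [← C.tySub_comp, ← C.tySub_comp, s.condition]
  · intro s
    apply C.hom_ext
    · rw [Category.assoc, C.up_p, ← Category.assoc, C.lift_p, s.condition]
    · refine (C.tmSub_comp _ _ _).trans ?_
      refine (C.tmSub_congr _ ?_ (C.up_q σ A)).trans ?_
      · rw [← C.tySub_comp, C.up_p, C.tySub_comp]
      · exact (C.lift_q _ _ _).trans (cast_heq _ _)
  · intro s
    exact C.lift_p _ _ _
  · intro s m h₁ h₂
    refine C.lift_uniq _ _ _ _ h₂ ?_
    refine HEq.trans ?_ (cast_heq _ _).symm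
    rw [← h₁]
    refine HEq.trans ?_ (C.tmSub_comp _ _ _).symm
    refine (C.tmSub_congr _ ?_ (C.up_q σ A)).symm
    rw [← C.tySub_comp, C.up_p, C.tySub_comp]

end CwF

/-- A `Σ`-CwF: a CwF whose family of types carries `1`- and `Σ`-type structures, that is, in
every context, types `1` and `Σ A B` together with bijections `Tm(1) ≅ {⋆}` and
`Tm(Σ A B) ≅ (a : A) × B(a)`, all stable under substitution. -/
structure SigmaCwF extends CwF.{u₁, v₁, w₁, t₁} where
  one : (Γ : Ctx) → Ty Γ
  one_sub : ∀ {Δ Γ : Ctx} (σ : Δ ⟶ Γ), tySub σ (one Γ) = one Δ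
  oneUnique : (Γ : Ctx) → Unique (Tm Γ (one Γ))
  sig : {Γ : Ctx} → (A : Ty Γ) → Ty (ext Γ A) → Ty Γ
  sig_sub : ∀ {Δ Γ : Ctx} (σ : Δ ⟶ Γ) (A : Ty Γ) (B : Ty (ext Γ A)),
    tySub σ (sig A B) = sig (tySub σ A) (tySub (toCwF.up σ A) B)
  pair : {Γ : Ctx} → {A : Ty Γ} → {B : Ty (ext Γ A)} → (a : Tm Γ A) →
    Tm Γ (tySub (toCwF.inst a) B) → Tm Γ (sig A B)
  pair_bijective : ∀ {Γ : Ctx} (A : Ty Γ) (B : Ty (ext Γ A)), Function.Bijective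
    (fun c : (a : Tm Γ A) × Tm Γ (tySub (toCwF.inst a) B) => pair (B := B) c.1 c.2)
  /-- `(a, b)[σ] = (a[σ], b[σ])`, where `b'` is `b[σ]` seen as a term of `B[σ](a[σ])`. -/
  pair_sub : ∀ {Δ Γ : Ctx} (σ : Δ ⟶ Γ) {A : Ty Γ} {B : Ty (ext Γ A)} (a : Tm Γ A)
    (b : Tm Γ (tySub (toCwF.inst a) B))
    (b' : Tm Δ (tySub (toCwF.inst (tmSub σ a)) (tySub (toCwF.up σ A) B))),
    HEq b' (tmSub σ b) → HEq (tmSub σ (pair a b)) (pair (tmSub σ a) b')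

/-! ## Morphisms of `Σ`-CwFs -/

/-- The data of a morphism of `Σ`-CwFs: a functor `F`, an action on types, and maps
`cmp : F(Γ.A) ⟶ F(Γ).F(A)` over `F(Γ)`. The action on a term `a : A` over `Γ` is the term of
`F(A)` over `F(Γ)` given by the section `F⟨id, a⟩ ≫ cmp` of the projection. -/
structure SigmaCwFHomData (C : SigmaCwF.{u₁, v₁, w₁, t₁}) (D : SigmaCwF.{u₂, v₂, w₂, t₂}) where
  functor : C.Ctx ⥤ D.Ctx
  ty : {Γ : C.Ctx} → C.Ty Γ → D.Ty (functor.obj Γ)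
  cmp : {Γ : C.Ctx} → (A : C.Ty Γ) →
    (functor.obj (C.ext Γ A) ⟶ D.ext (functor.obj Γ) (ty A))
  cmp_p : ∀ {Γ : C.Ctx} (A : C.Ty Γ), cmp A ≫ D.p (ty A) = functor.map (C.p A)

/-- The conditions under which such data is a morphism of `Σ`-CwFs, all structure being
preserved up to canonical isomorphism (the quotient set of a total setoid is isomorphic to a set
of pairs, not equal to one). The types `1` and `Σ A B` are then preserved as well, because
`Γ.1 ≅ Γ` and `Γ.(Σ A B) ≅ Γ.A.B` over `Γ`: see `IsHom.isIso_p_one` and `IsHom.exists_sig_iso`. -/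
structure SigmaCwFHomData.IsHom {C : SigmaCwF.{u₁, v₁, w₁, t₁}} {D : SigmaCwF.{u₂, v₂, w₂, t₂}}
    (F : SigmaCwFHomData C D) : Prop where
  /-- The empty context is preserved. -/
  terminal : Nonempty (IsTerminal (F.functor.obj C.empty))
  /-- Context extensions are preserved: `F(Γ.A) ≅ F(Γ).F(A)` over `F(Γ)`. -/
  isIso_cmp : ∀ {Γ : C.Ctx} (A : C.Ty Γ), IsIso (F.cmp A)
  /-- Substitution is preserved, `F(A[σ]) ≅ F(A)[F(σ)]`: the substitution square of `A` along
  `σ`, which is a pullback, is sent to a pullback. -/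
  subst : ∀ {Δ Γ : C.Ctx} (σ : Δ ⟶ Γ) (A : C.Ty Γ),
    IsPullback (F.functor.map (C.up σ A)) (F.functor.map (C.p (C.tySub σ A)))
      (F.functor.map (C.p A)) (F.functor.map σ)

/-- Morphisms of `Σ`-CwFs. -/
structure SigmaCwFHom (C : SigmaCwF.{u₁, v₁, w₁, t₁}) (D : SigmaCwF.{u₂, v₂, w₂, t₂}) where
  toData : SigmaCwFHomData C D
  isHom : toData.IsHom

/-! ### Unit types and `Σ`-types are preserved by every morphism -/

namespace CwF

variable (C : CwF.{u₁, v₁, w₁, t₁})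

theorem inst_p {Γ : C.Ctx} {A : C.Ty Γ} (a : C.Tm Γ A) : C.inst a ≫ C.p A = 𝟙 Γ :=
  C.lift_p _ _ _

theorem inst_q {Γ : C.Ctx} {A : C.Ty Γ} (a : C.Tm Γ A) : HEq (C.tmSub (C.inst a) (C.q A)) a :=
  (C.lift_q _ _ _).trans (cast_heq _ _)

theorem inst_up {Δ Γ : C.Ctx} (σ : Δ ⟶ Γ) {A : C.Ty Γ} (a : C.Tm Δ (C.tySub σ A)) :
    C.inst a ≫ C.up σ A = C.lift σ A a := by
  refine C.lift_uniq _ _ _ _ ?_ ?_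
  · rw [Category.assoc, C.up_p, ← Category.assoc, C.inst_p, Category.id_comp]
  · refine (C.tmSub_comp _ _ _).trans ((C.tmSub_congr _ ?_ (C.up_q σ A)).trans (C.inst_q a))
    rw [← C.tySub_comp, C.up_p, C.tySub_comp]

theorem comp_lift {Θ Δ Γ : C.Ctx} (τ : Θ ⟶ Δ) (σ : Δ ⟶ Γ) {A : C.Ty Γ}
    (a : C.Tm Δ (C.tySub σ A)) (a' : C.Tm Θ (C.tySub (τ ≫ σ) A)) (h : HEq a' (C.tmSub τ a)) :
    τ ≫ C.lift σ A a = C.lift (τ ≫ σ) A a' := by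
  refine C.lift_uniq _ _ _ _ (by rw [Category.assoc, C.lift_p]) ?_
  refine (C.tmSub_comp _ _ _).trans ((C.tmSub_congr _ ?_ (C.lift_q σ A a)).trans h.symm)
  rw [← C.tySub_comp, C.lift_p]

theorem tmSub_congr_hom {Δ Γ : C.Ctx} {σ σ' : Δ ⟶ Γ} (h : σ = σ') {A : C.Ty Γ} (a : C.Tm Γ A) :
    HEq (C.tmSub σ a) (C.tmSub σ' a) := by
  subst h; rfl

end CwF

namespace SigmaCwF

variable (C : SigmaCwF.{u₁, v₁, w₁, t₁})

/-- Pairing over `σ : Δ ⟶ Γ`. -/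
def pairAt {Δ Γ : C.Ctx} (σ : Δ ⟶ Γ) {A : C.Ty Γ} {B : C.Ty (C.ext Γ A)}
    (a : C.Tm Δ (C.tySub σ A)) (b : C.Tm Δ (C.tySub (C.lift σ A a) B)) :
    C.Tm Δ (C.tySub σ (C.sig A B)) :=
  cast (congrArg (C.Tm Δ) (C.sig_sub σ A B).symm) (C.pair a
    (cast (congrArg (C.Tm Δ) (by rw [← C.tySub_comp, C.inst_up])) b))

theorem pairAt_congr {Δ Γ : C.Ctx} {σ σ' : Δ ⟶ Γ} (h : σ = σ') {A : C.Ty Γ}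
    {B : C.Ty (C.ext Γ A)} {a : C.Tm Δ (C.tySub σ A)} {b : C.Tm Δ (C.tySub (C.lift σ A a) B)}
    {a' : C.Tm Δ (C.tySub σ' A)} {b' : C.Tm Δ (C.tySub (C.lift σ' A a') B)}
    (ha : HEq a a') (hb : HEq b b') : HEq (C.pairAt σ a b) (C.pairAt σ' a' b') := by
  subst h; cases ha; cases hb; rfl

theorem pairAt_inj {Δ Γ : C.Ctx} {σ : Δ ⟶ Γ} {A : C.Ty Γ}
    {B : C.Ty (C.ext Γ A)} {a : C.Tm Δ (C.tySub σ A)} {b : C.Tm Δ (C.tySub (C.lift σ A a) B)}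
    {a' : C.Tm Δ (C.tySub σ A)} {b' : C.Tm Δ (C.tySub (C.lift σ A a') B)}
    (h : C.pairAt σ a b = C.pairAt σ a' b') : a = a' ∧ HEq b b' := by
  unfold pairAt at h
  have := (C.pair_bijective _ _).1 (a₁ := ⟨_, _⟩) (a₂ := ⟨_, _⟩) ((cast_inj _).1 h)
  obtain ⟨rfl, h⟩ := Sigma.mk.inj this
  exact ⟨rfl, heq_of_eq ((cast_inj _).1 (eq_of_heq h))⟩

theorem pairAt_surj {Δ Γ : C.Ctx} (σ : Δ ⟶ Γ) {A : C.Ty Γ} {B : C.Ty (C.ext Γ A)}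
    (c : C.Tm Δ (C.tySub σ (C.sig A B))) : ∃ a b, C.pairAt σ (A := A) (B := B) a b = c := by
  obtain ⟨⟨a, b⟩, h⟩ := (C.pair_bijective _ _).2 (cast (congrArg (C.Tm Δ) (C.sig_sub σ A B)) c)
  refine ⟨a, cast (congrArg (C.Tm Δ) (by rw [← C.tySub_comp, C.inst_up])) b, ?_⟩
  simp only at h
  simp [pairAt, h]

theorem pair_congr {Γ : C.Ctx} {A A' : C.Ty Γ} (hA : A = A') {B : C.Ty (C.ext Γ A)}
    {B' : C.Ty (C.ext Γ A')} (hB : HEq B B') {a : C.Tm Γ A} {a' : C.Tm Γ A'} (ha : HEq a a')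
    {b : C.Tm Γ (C.tySub (C.inst a) B)} {b' : C.Tm Γ (C.tySub (C.inst a') B')} (hb : HEq b b') :
    HEq (C.pair a b) (C.pair a' b') := by
  subst hA; cases hB; cases ha; cases hb; rfl

theorem up_congr {Θ Γ : C.Ctx} {A : C.Ty Γ} (B : C.Ty (C.ext Γ A)) {A₁ A₂ : C.Ty Θ}
    (h : A₁ = A₂) {f : C.ext Θ A₁ ⟶ C.ext Γ A} {g : C.ext Θ A₂ ⟶ C.ext Γ A}
    (hp : HEq (f ≫ C.p A) (g ≫ C.p A))
    (hq : HEq (C.tmSub f (C.q A)) (C.tmSub g (C.q A))) :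
    HEq (C.tySub f B) (C.tySub g B) := by
  subst h
  rw [C.hom_ext (eq_of_heq hp) hq]

theorem pairAt_sub {Θ Δ Γ : C.Ctx} (τ : Θ ⟶ Δ) (σ : Δ ⟶ Γ) {A : C.Ty Γ} {B : C.Ty (C.ext Γ A)}
    (a : C.Tm Δ (C.tySub σ A)) (b : C.Tm Δ (C.tySub (C.lift σ A a) B))
    (a' : C.Tm Θ (C.tySub (τ ≫ σ) A)) (b' : C.Tm Θ (C.tySub (C.lift (τ ≫ σ) A a') B))
    (ha : HEq a' (C.tmSub τ a)) (hb : HEq b' (C.tmSub τ b)) :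
    HEq (C.tmSub τ (C.pairAt σ a b)) (C.pairAt (τ ≫ σ) a' b') := by
  have e₁ : C.tySub (C.inst (C.tmSub τ a)) (C.tySub (C.up τ _) (C.tySub (C.up σ A) B)) =
      C.tySub (C.lift (τ ≫ σ) A a') B := by
    rw [← C.comp_lift τ σ a a' ha, ← C.inst_up σ, ← C.tySub_comp, ← C.tySub_comp,
      ← Category.assoc, C.inst_up τ]
    congr 2
    refine (C.hom_ext ?_ ?_)
    · rw [C.lift_p, Category.assoc, C.inst_p, Category.comp_id]
    · refine (C.lift_q _ _ _).trans (HEq.symm ((C.tmSub_comp _ _ _).trans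
        (C.tmSub_congr _ ?_ (C.inst_q a))))
      rw [← C.tySub_comp, C.inst_p, C.tySub_id]
  have h := C.pair_sub τ a (cast (congrArg (C.Tm Δ) (by rw [← C.tySub_comp, C.inst_up])) b)
    (B := C.tySub (C.up σ A) B) (cast (congrArg (C.Tm Θ) e₁.symm) b') (by
      refine (cast_heq _ _).trans (hb.trans (C.tmSub_congr _ ?_ (cast_heq _ _).symm))
      rw [← C.tySub_comp, C.inst_up])
  refine (C.tmSub_congr _ (C.sig_sub σ A B) (cast_heq _ _)).trans (h.trans ?_)
  refine HEq.trans ?_ (cast_heq _ _).symm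
  refine C.pair_congr (C.tySub_comp τ σ A).symm ?_ ha.symm
    ((cast_heq _ _).trans (cast_heq _ _).symm)
  rw [← C.tySub_comp (C.up τ _) (C.up σ A) B]
  have e : C.tySub τ (C.tySub σ A) = C.tySub (τ ≫ σ) A := (C.tySub_comp τ σ A).symm
  have key : ∀ (A' : C.Ty Θ) (_ : A' = C.tySub τ (C.tySub σ A)),
      HEq (C.p (C.tySub τ (C.tySub σ A)) ≫ τ ≫ σ) (C.p A' ≫ τ ≫ σ) := by
    rintro _ rfl; rfl
  refine C.up_congr B e ?_ ?_
  · rw [Category.assoc, C.up_p, ← Category.assoc, C.up_p, C.up_p, Category.assoc]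
    exact key _ e.symm
  · refine (C.tmSub_comp _ _ _).trans ((C.tmSub_congr _ ?_ (C.up_q σ A)).trans
      ((C.up_q τ _).trans (HEq.trans ?_ (C.up_q (τ ≫ σ) A).symm)))
    · rw [← C.tySub_comp, C.up_p, C.tySub_comp]
    · rw [e]

theorem lift_p_q {Γ : C.Ctx} {A : C.Ty Γ} (B : C.Ty (C.ext Γ A)) :
    C.lift (C.p B ≫ C.p A) A (cast (congrArg (C.Tm _) (C.tySub_comp _ _ A).symm)
      (C.tmSub (C.p B) (C.q A))) = C.p B :=
  (C.lift_uniq _ _ _ _ rfl (cast_heq _ _).symm).symm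

/-- The canonical morphism `Γ.A.B ⟶ Γ.Σ A B` over `Γ`. -/
def pairMap {Γ : C.Ctx} (A : C.Ty Γ) (B : C.Ty (C.ext Γ A)) :
    C.ext (C.ext Γ A) B ⟶ C.ext Γ (C.sig A B) :=
  C.lift (C.p B ≫ C.p A) (C.sig A B) (C.pairAt (C.p B ≫ C.p A)
    (cast (congrArg (C.Tm _) (C.tySub_comp _ _ A).symm) (C.tmSub (C.p B) (C.q A)))
    (cast (congrArg (fun f => C.Tm _ (C.tySub f B)) (C.lift_p_q B).symm) (C.q B)))

theorem pairMap_p {Γ : C.Ctx} (A : C.Ty Γ) (B : C.Ty (C.ext Γ A)) :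
    C.pairMap A B ≫ C.p (C.sig A B) = C.p B ≫ C.p A :=
  C.lift_p _ _ _

theorem comp_pairMap {Δ Γ : C.Ctx} (A : C.Ty Γ) (B : C.Ty (C.ext Γ A)) (σ : Δ ⟶ Γ)
    (a : C.Tm Δ (C.tySub σ A)) (b : C.Tm Δ (C.tySub (C.lift σ A a) B)) :
    C.lift (C.lift σ A a) B b ≫ C.pairMap A B = C.lift σ (C.sig A B) (C.pairAt σ a b) := by
  refine C.lift_uniq _ _ _ _ ?_ ?_
  · rw [Category.assoc, C.pairMap_p, ← Category.assoc, C.lift_p, C.lift_p]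
  · refine (C.tmSub_comp _ _ _).trans ((C.tmSub_congr _ ?_ (C.lift_q _ _ _)).trans ?_)
    · rw [← C.tySub_comp]; exact congrArg (fun f => C.tySub f _) (C.pairMap_p A B)
    · have hσ : C.lift (C.lift σ A a) B b ≫ C.p B ≫ C.p A = σ := by
        rw [← Category.assoc, C.lift_p, C.lift_p]
      have ha : HEq (cast (congrArg (fun f => C.Tm _ (C.tySub f A)) hσ.symm) a)
          (C.tmSub (C.lift (C.lift σ A a) B b) (cast (congrArg (C.Tm _)
            (C.tySub_comp _ _ A).symm) (C.tmSub (C.p B) (C.q A)))) := by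
        refine (cast_heq _ _).trans (HEq.symm ?_)
        refine (C.tmSub_congr _ (C.tySub_comp _ _ A) (cast_heq _ _)).trans ?_
        refine (C.tmSub_comp _ _ _).symm.trans ?_
        exact (C.tmSub_congr_hom (C.lift_p _ _ _) _).trans (C.lift_q _ _ _)
      have hl : C.lift σ A a = C.lift _ A (cast (congrArg (fun f => C.Tm _ (C.tySub f A))
          hσ.symm) a) := by
        refine C.lift_uniq _ _ _ _ ((C.lift_p _ _ _).trans hσ.symm)
          ((C.lift_q _ _ _).trans (cast_heq _ _).symm)
      refine (C.pairAt_sub _ _ _ _ (cast (congrArg (fun f => C.Tm _ (C.tySub f A)) hσ.symm) a)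
        (cast (congrArg (fun f => C.Tm _ (C.tySub f B)) hl) b) ha ?_).trans ?_
      · refine (cast_heq _ _).trans (HEq.symm ?_)
        exact (C.tmSub_congr _ (congrArg (fun f => C.tySub f B) (C.lift_p_q B))
          (cast_heq _ _)).trans (C.lift_q _ _ _)
      · exact C.pairAt_congr hσ (cast_heq _ _) (cast_heq _ _)

theorem exists_lift {Δ Γ : C.Ctx} {A : C.Ty Γ} (f : Δ ⟶ C.ext Γ A) :
    ∃ a : C.Tm Δ (C.tySub (f ≫ C.p A) A), f = C.lift (f ≫ C.p A) A a :=
  ⟨cast (congrArg (C.Tm _) (C.tySub_comp _ _ A).symm) (C.tmSub f (C.q A)),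
    C.lift_uniq _ _ _ _ rfl (cast_heq _ _).symm⟩

theorem exists_lift_lift {Δ Γ : C.Ctx} {A : C.Ty Γ} {B : C.Ty (C.ext Γ A)}
    (f : Δ ⟶ C.ext (C.ext Γ A) B) : ∃ (σ : Δ ⟶ Γ) (a : C.Tm Δ (C.tySub σ A))
      (b : C.Tm Δ (C.tySub (C.lift σ A a) B)), f = C.lift (C.lift σ A a) B b := by
  obtain ⟨b, hb⟩ := C.exists_lift f
  obtain ⟨a, ha⟩ := C.exists_lift (f ≫ C.p B)
  generalize f ≫ C.p B = g at b hb a ha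
  generalize g ≫ C.p A = σ at a ha
  subst ha
  exact ⟨σ, a, b, hb⟩

theorem lift_inj {Δ Γ : C.Ctx} {σ σ' : Δ ⟶ Γ} {A : C.Ty Γ} {a : C.Tm Δ (C.tySub σ A)}
    {a' : C.Tm Δ (C.tySub σ' A)} (h : C.lift σ A a = C.lift σ' A a') : σ = σ' ∧ HEq a a' := by
  refine ⟨by rw [← C.lift_p σ A a, h, C.lift_p], ?_⟩
  exact (C.lift_q _ _ _).symm.trans ((C.tmSub_congr_hom h _).trans (C.lift_q _ _ _))

/-- The context extension by a `Σ`-type is the iterated context extension. -/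
theorem isIso_pairMap {Γ : C.Ctx} (A : C.Ty Γ) (B : C.Ty (C.ext Γ A)) :
    IsIso (C.pairMap A B) := by
  have hmono : Mono (C.pairMap A B) := by
    refine ⟨fun f g h => ?_⟩
    obtain ⟨σ, a, b, rfl⟩ := C.exists_lift_lift f
    obtain ⟨σ', a', b', rfl⟩ := C.exists_lift_lift g
    rw [C.comp_pairMap, C.comp_pairMap] at h
    obtain ⟨rfl, h⟩ := C.lift_inj h
    obtain ⟨rfl, h⟩ := C.pairAt_inj (eq_of_heq h)
    obtain rfl := eq_of_heq h
    rfl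
  have hsplit : ∃ s, s ≫ C.pairMap A B = 𝟙 _ := by
    obtain ⟨c, hc⟩ := C.exists_lift (𝟙 (C.ext Γ (C.sig A B)))
    obtain ⟨a, b, rfl⟩ := C.pairAt_surj _ c
    exact ⟨_, (C.comp_pairMap A B _ a b).trans hc.symm⟩
  obtain ⟨s, hs⟩ := hsplit
  refine ⟨s, ?_, hs⟩
  rw [← cancel_mono (C.pairMap A B), Category.assoc, hs, Category.comp_id, Category.id_comp]

/-- The context extension by the unit type is trivial. -/
theorem isIso_p_one (Γ : C.Ctx) : IsIso (C.p (C.one Γ)) := by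
  refine ⟨C.inst (C.oneUnique Γ).default, C.hom_ext ?_ ?_, C.inst_p _⟩
  · rw [Category.assoc, C.inst_p, Category.id_comp, Category.comp_id]
  · have : ∀ (Δ : C.Ctx) (X Y : C.Ty Δ) (_ : X = C.one Δ) (_ : Y = C.one Δ) (x : C.Tm Δ X)
        (y : C.Tm Δ Y), HEq x y := by
      rintro Δ _ _ rfl rfl x y
      exact heq_of_eq (((C.oneUnique Δ).uniq x).trans ((C.oneUnique Δ).uniq y).symm)
    exact this _ _ _ (by rw [C.one_sub, C.one_sub]) (by rw [C.one_sub, C.one_sub]) _ _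

end SigmaCwF

namespace SigmaCwFHomData.IsHom

variable {C : SigmaCwF.{u₁, v₁, w₁, t₁}} {D : SigmaCwF.{u₂, v₂, w₂, t₂}}
  {F : SigmaCwFHomData C D}

/-- Morphisms preserve the unit types: `F(1)` is isomorphic to `1`. -/
theorem isIso_p_one (hF : F.IsHom) (Γ : C.Ctx) : IsIso (D.p (F.ty (C.one Γ))) := by
  have := hF.isIso_cmp (C.one Γ)
  have := C.isIso_p_one Γ
  have h : IsIso (F.cmp (C.one Γ) ≫ D.p (F.ty (C.one Γ))) := by
    rw [F.cmp_p]; infer_instance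
  exact IsIso.of_isIso_comp_left (F.cmp (C.one Γ)) _

/-- Morphisms preserve the `Σ`-types and their pairing: `F(Σ A B)` is isomorphic over `F(Γ)` to
`Σ F(A) B'`, where `B'` is `F(B)` transported along `F(Γ).F(A) ≅ F(Γ.A)`, by an isomorphism which
sends the image by `F` of the pair of generic terms to the pair of their images. -/
theorem exists_sig_iso (hF : F.IsHom) {Γ : C.Ctx} (A : C.Ty Γ) (B : C.Ty (C.ext Γ A)) :
    ∃ (i : D.ext (F.functor.obj Γ) (F.ty A) ⟶ F.functor.obj (C.ext Γ A))
      (e : D.ext (F.functor.obj Γ) (D.sig (F.ty A) (D.tySub i (F.ty B))) ≅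
        D.ext (F.functor.obj Γ) (F.ty (C.sig A B)))
      (b : D.ext (D.ext (F.functor.obj Γ) (F.ty A)) (D.tySub i (F.ty B)) ≅
        F.functor.obj (C.ext (C.ext Γ A) B)),
      i ≫ F.cmp A = 𝟙 _ ∧ F.cmp A ≫ i = 𝟙 _ ∧
      e.hom ≫ D.p _ = D.p _ ∧ b.hom ≫ F.cmp B = D.up i (F.ty B) ∧
      D.pairMap _ _ ≫ e.hom = b.hom ≫ F.functor.map (C.pairMap A B) ≫ F.cmp (C.sig A B) := by
  have := hF.isIso_cmp A
  have := hF.isIso_cmp B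
  have := hF.isIso_cmp (C.sig A B)
  have := C.isIso_pairMap A B
  have := D.isIso_pairMap (F.ty A) (D.tySub (inv (F.cmp A)) (F.ty B))
  have h := D.isPullback_up (inv (F.cmp A)) (F.ty B)
  have : IsIso (D.up (inv (F.cmp A)) (F.ty B)) := h.isIso_fst_of_isIso
  refine ⟨inv (F.cmp A), (asIso (D.pairMap (F.ty A) (D.tySub (inv (F.cmp A)) (F.ty B)))).symm ≪≫
    asIso (D.up (inv (F.cmp A)) (F.ty B)) ≪≫ (asIso (F.cmp B)).symm ≪≫
    asIso (F.functor.map (C.pairMap A B)) ≪≫ asIso (F.cmp (C.sig A B)),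
    asIso (D.up (inv (F.cmp A)) (F.ty B)) ≪≫ (asIso (F.cmp B)).symm, by simp, by simp, ?_, by simp,
    by simp⟩
  simp only [Iso.trans_hom, Iso.symm_hom, asIso_inv, asIso_hom, Category.assoc, F.cmp_p]
  rw [IsIso.inv_comp_eq, ← F.functor.map_comp, C.pairMap_p, F.functor.map_comp, ← F.cmp_p B,
    D.pairMap_p, ← F.cmp_p A]
  have h' := D.up_p (inv (F.cmp A)) (F.ty B)
  simp only [Category.assoc, IsIso.inv_hom_id_assoc]
  rw [← Category.assoc, h']
  simp

end SigmaCwFHomData.IsHom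

namespace SigmaCwFHomData

variable {C : SigmaCwF.{u₁, v₁, w₁, t₁}} {D : SigmaCwF.{u₂, v₂, w₂, t₂}}
  {E : SigmaCwF.{u₃, v₃, w₃, t₃}}

/-- The composite `G ∘ F`. -/
def comp (F : SigmaCwFHomData C D) (G : SigmaCwFHomData D E) : SigmaCwFHomData C E where
  functor := F.functor ⋙ G.functor
  ty A := G.ty (F.ty A)
  cmp A := G.functor.map (F.cmp A) ≫ G.cmp (F.ty A)
  cmp_p A := by
    rw [Category.assoc, G.cmp_p, ← G.functor.map_comp, F.cmp_p]; rfl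

theorem IsHom.comp {F : SigmaCwFHomData C D} {G : SigmaCwFHomData D E} (hF : F.IsHom)
    (hG : G.IsHom) : (F.comp G).IsHom where
  terminal := by
    obtain ⟨t⟩ := hF.terminal
    obtain ⟨t'⟩ := hG.terminal
    exact ⟨t'.ofIso (G.functor.mapIso (D.emptyIsTerminal.uniqueUpToIso t))⟩
  isIso_cmp A := by
    have := hF.isIso_cmp A
    have := hG.isIso_cmp (F.ty A)
    dsimp only [SigmaCwFHomData.comp]
    infer_instance
  subst {Δ Γ} σ A := by
    have := hF.isIso_cmp A
    have h₁ := hF.subst σ A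
    have h₂ := D.isPullback_up (F.functor.map σ) (F.ty A)
    have h₃ : IsPullback (F.functor.map (C.up σ A) ≫ F.cmp A)
        (F.functor.map (C.p (C.tySub σ A))) (D.p (F.ty A)) (F.functor.map σ) := by
      refine IsPullback.of_iso h₁ (Iso.refl _) (asIso (F.cmp A)) (Iso.refl _) (Iso.refl _)
        ?_ ?_ ?_ ?_ <;> simp [F.cmp_p]
    let e := h₃.isoIsPullback _ _ h₂
    refine IsPullback.of_iso (hG.subst (F.functor.map σ) (F.ty A))
      (G.functor.mapIso e.symm) (G.functor.mapIso (asIso (F.cmp A)).symm) (Iso.refl _)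
      (Iso.refl _) ?_ ?_ ?_ ?_
    · simp only [Functor.mapIso_hom, Iso.symm_hom, asIso_inv]
      have : e.inv ≫ F.functor.map (C.up σ A) ≫ F.cmp A = D.up (F.functor.map σ) (F.ty A) :=
        h₃.isoIsPullback_inv_fst _ _ h₂
      simp only [SigmaCwFHomData.comp, Functor.comp_map, ← G.functor.map_comp]
      congr 1
      rw [IsIso.comp_inv_eq, Category.assoc, this]
    · simp only [Functor.mapIso_hom, Iso.symm_hom, Iso.refl_hom, Category.comp_id,
        SigmaCwFHomData.comp, Functor.comp_map, ← G.functor.map_comp]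
      exact congrArg _ (h₃.isoIsPullback_inv_snd _ _ h₂).symm
    · simp only [Functor.mapIso_hom, Iso.symm_hom, Iso.refl_hom, Category.comp_id, asIso_inv,
        SigmaCwFHomData.comp, Functor.comp_map, ← G.functor.map_comp]
      congr 1
      rw [IsIso.eq_inv_comp, F.cmp_p]
    · simp [SigmaCwFHomData.comp]

end SigmaCwFHomData

/-- Composition of morphisms of `Σ`-CwFs. -/
def SigmaCwFHom.comp {C : SigmaCwF.{u₁, v₁, w₁, t₁}} {D : SigmaCwF.{u₂, v₂, w₂, t₂}}
    {E : SigmaCwF.{u₃, v₃, w₃, t₃}} (F : SigmaCwFHom C D) (G : SigmaCwFHom D E) :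
    SigmaCwFHom C E :=
  ⟨F.toData.comp G.toData, F.isHom.comp G.isHom⟩

/-! ## The `Σ`-CwF of sets -/

/-- The CwF of sets: types over `X` are families of sets indexed by `X`. -/
abbrev SetCwF₀ : CwF.{u + 1, u, u + 1, u} where
  Ctx := Type u
  empty := PUnit
  emptyIsTerminal := Types.isTerminalPUnit
  Ty X := X → Type u
  Tm X A := (x : X) → A x
  tySub σ A := fun x => A (σ x)
  tySub_id _ := rfl
  tySub_comp _ _ _ := rfl
  tmSub σ _ a := fun x => a (σ x)
  tmSub_id _ := HEq.rfl
  tmSub_comp _ _ _ _ := HEq.rfl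
  ext X A := (x : X) × A x
  p _ := ↾Sigma.fst
  q _ := fun z => z.2
  lift σ _ a := ↾fun x => ⟨σ x, a x⟩
  lift_p _ _ _ := rfl
  lift_q _ _ _ := HEq.rfl
  lift_uniq := by
    rintro Δ Γ _ A a τ rfl h
    obtain rfl := eq_of_heq h
    rfl

/-- The `Σ`-CwF of sets. -/
abbrev SetCwF : SigmaCwF.{u + 1, u, u + 1, u} where
  toCwF := SetCwF₀
  one X := fun _ => PUnit
  one_sub _ := rfl
  oneUnique X := inferInstanceAs (Unique (X → PUnit))
  sig A B := fun x => (a : A x) × B ⟨x, a⟩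
  sig_sub _ _ _ := rfl
  pair a b := fun x => ⟨a x, b x⟩
  pair_bijective A B := by
    constructor
    · rintro ⟨a, b⟩ ⟨a', b'⟩ h
      have h₁ : a = a' := funext fun x => congrArg Sigma.fst (congrFun h x)
      subst h₁
      have h₂ : b = b' := funext fun x => by
        have := congrFun h x
        exact eq_of_heq (Sigma.mk.inj this).2
      subst h₂
      rfl
    · intro c
      exact ⟨⟨fun x => (c x).1, fun x => (c x).2⟩, rfl⟩
  pair_sub σ A B a b b' h := by
    obtain rfl := eq_of_heq h
    rfl

/-! ## The `Σ`-CwF of setoids -/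

/-- A setoid: a set with an equivalence relation. -/
structure SetoidCat where
  carrier : Type u
  str : Setoid carrier

/-- A morphism of setoids: a function preserving the equivalence relations. -/
@[ext]
structure SetoidHom (X Y : SetoidCat.{u}) where
  toFun : X.carrier → Y.carrier
  map_rel : ∀ {x₁ x₂ : X.carrier}, X.str x₁ x₂ → Y.str (toFun x₁) (toFun x₂)

instance : Category.{u} SetoidCat.{u} where
  Hom := SetoidHom
  id X := ⟨fun x => x, fun h => h⟩
  comp f g := ⟨fun x => g.toFun (f.toFun x), fun h => g.map_rel (f.map_rel h)⟩

/-- A dependent setoid over a setoid: a family of sets with a dependent equivalence relation.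
The relation `rel x₁ x₂ y₁ y₂` presupposes `x₁ ∼ x₂`. -/
@[ext]
structure DepSetoid (X : SetoidCat.{u}) where
  fam : X.carrier → Type u
  rel : (x₁ x₂ : X.carrier) → fam x₁ → fam x₂ → Prop
  base : ∀ {x₁ x₂ : X.carrier} {y₁ : fam x₁} {y₂ : fam x₂}, rel x₁ x₂ y₁ y₂ → X.str x₁ x₂
  refl : ∀ {x : X.carrier} (y : fam x), rel x x y y
  symm : ∀ {x₁ x₂ : X.carrier} {y₁ : fam x₁} {y₂ : fam x₂},
    rel x₁ x₂ y₁ y₂ → rel x₂ x₁ y₂ y₁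
  trans : ∀ {x₁ x₂ x₃ : X.carrier} {y₁ : fam x₁} {y₂ : fam x₂} {y₃ : fam x₃},
    rel x₁ x₂ y₁ y₂ → rel x₂ x₃ y₂ y₃ → rel x₁ x₃ y₁ y₃

namespace DepSetoid

/-- Fibrancy: for `x₁ ∼ x₂` and `y₁` over `x₁` there is `y₂ ∼ y₁` over `x₂`. -/
def IsFibrant {X : SetoidCat.{u}} (Y : DepSetoid X) : Prop :=
  ∀ (x₁ x₂ : X.carrier), X.str x₁ x₂ → ∀ y₁ : Y.fam x₁, ∃ y₂ : Y.fam x₂, Y.rel x₁ x₂ y₁ y₂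

/-- Pullback of a dependent setoid along a morphism. -/
def sub {A X : SetoidCat.{u}} (f : A ⟶ X) (Y : DepSetoid X) : DepSetoid A where
  fam a := Y.fam (f.toFun a)
  rel a₁ a₂ y₁ y₂ := A.str a₁ a₂ ∧ Y.rel (f.toFun a₁) (f.toFun a₂) y₁ y₂
  base h := h.1
  refl y := ⟨A.str.refl _, Y.refl y⟩
  symm h := ⟨A.str.symm h.1, Y.symm h.2⟩
  trans h h' := ⟨A.str.trans h.1 h'.1, Y.trans h.2 h'.2⟩

/-- The total setoid of a dependent setoid. -/
def total {X : SetoidCat.{u}} (Y : DepSetoid X) : SetoidCat.{u} where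
  carrier := (x : X.carrier) × Y.fam x
  str :=
    { r := fun z₁ z₂ => Y.rel z₁.1 z₂.1 z₁.2 z₂.2
      iseqv := ⟨fun z => Y.refl z.2, fun h => Y.symm h, fun h h' => Y.trans h h'⟩ }

/-- The projection from the total setoid. -/
def proj {X : SetoidCat.{u}} (Y : DepSetoid X) : Y.total ⟶ X :=
  ⟨Sigma.fst, fun h => Y.base h⟩

/-- Terms of a dependent setoid: sections preserving the relations. -/
@[ext]
structure Section {X : SetoidCat.{u}} (Y : DepSetoid X) where
  toFun : (x : X.carrier) → Y.fam x
  map_rel : ∀ {x₁ x₂ : X.carrier}, X.str x₁ x₂ → Y.rel x₁ x₂ (toFun x₁) (toFun x₂)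

/-- The unit dependent setoid. -/
def one (X : SetoidCat.{u}) : DepSetoid X where
  fam _ := PUnit
  rel x₁ x₂ _ _ := X.str x₁ x₂
  base h := h
  refl _ := X.str.refl _
  symm h := X.str.symm h
  trans h h' := X.str.trans h h'

/-- Dependent pairs of dependent setoids. -/
def sig {X : SetoidCat.{u}} (Y : DepSetoid X) (Z : DepSetoid Y.total) : DepSetoid X where
  fam x := (y : Y.fam x) × Z.fam ⟨x, y⟩
  rel x₁ x₂ w₁ w₂ := Z.rel ⟨x₁, w₁.1⟩ ⟨x₂, w₂.1⟩ w₁.2 w₂.2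
  base h := Y.base (Z.base h)
  refl w := Z.refl w.2
  symm h := Z.symm h
  trans h h' := Z.trans h h'

theorem sub_id {X : SetoidCat.{u}} (Y : DepSetoid X) : sub (𝟙 X) Y = Y := by
  refine DepSetoid.ext rfl (heq_of_eq ?_)
  funext x₁ x₂ y₁ y₂
  exact propext ⟨fun h => h.2, fun h => ⟨Y.base h, h⟩⟩

theorem sub_comp {B A X : SetoidCat.{u}} (g : B ⟶ A) (f : A ⟶ X) (Y : DepSetoid X) :
    sub (g ≫ f) Y = sub g (sub f Y) := by
  refine DepSetoid.ext rfl (heq_of_eq ?_)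
  funext x₁ x₂ y₁ y₂
  exact propext ⟨fun h => ⟨h.1, g.map_rel h.1, h.2⟩, fun h => ⟨h.1, h.2.2⟩⟩

/-- Substitution in a section. -/
def Section.sub {A X : SetoidCat.{u}} (f : A ⟶ X) {Y : DepSetoid X} (s : Y.Section) :
    (DepSetoid.sub f Y).Section :=
  ⟨fun a => s.toFun (f.toFun a), fun h => ⟨h, s.map_rel (f.map_rel h)⟩⟩

/-- The generic section. -/
def gen {X : SetoidCat.{u}} (Y : DepSetoid X) : (DepSetoid.sub Y.proj Y).Section :=
  ⟨fun z => z.2, fun h => ⟨h, h⟩⟩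

/-- The morphism to the total setoid given by a morphism and a section. -/
def lift {A X : SetoidCat.{u}} (f : A ⟶ X) (Y : DepSetoid X) (s : (sub f Y).Section) :
    A ⟶ Y.total :=
  ⟨fun a => ⟨f.toFun a, s.toFun a⟩, fun h => (s.map_rel h).2⟩

theorem Section.heq {X : SetoidCat.{u}} {Y Y' : DepSetoid X} (h : Y = Y') {s : Y.Section}
    {s' : Y'.Section} (hs : HEq s.toFun s'.toFun) : HEq s s' := by
  subst h
  exact heq_of_eq (Section.ext (eq_of_heq hs))

theorem Section.toFun_heq {X : SetoidCat.{u}} {Y Y' : DepSetoid X} (h : Y = Y') {s : Y.Section}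
    {s' : Y'.Section} (hs : HEq s s') : HEq s.toFun s'.toFun := by
  subst h
  cases hs
  rfl

theorem Section.cast_toFun {X : SetoidCat.{u}} {Y Y' : DepSetoid X} (h : Y = Y')
    (e : Y.Section = Y'.Section) (s : Y.Section) : HEq (cast e s).toFun s.toFun := by
  subst h
  rfl

theorem lift_uniq {A X : SetoidCat.{u}} (f : A ⟶ X) (Y : DepSetoid X) (s : (sub f Y).Section)
    (g : A ⟶ Y.total) (hg : g ≫ Y.proj = f) (h : HEq (Section.sub g Y.gen) s) :
    g = lift f Y s := by
  subst hg
  have := Section.toFun_heq (sub_comp g Y.proj Y).symm h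
  refine SetoidHom.ext (funext fun a => ?_)
  exact congrArg (Sigma.mk _) (congrFun (eq_of_heq this) a)

theorem IsFibrant.sub {A X : SetoidCat.{u}} (f : A ⟶ X) {Y : DepSetoid X} (h : Y.IsFibrant) :
    (DepSetoid.sub f Y).IsFibrant := fun _ _ ha y₁ =>
  (h _ _ (f.map_rel ha) y₁).imp fun _ hy => ⟨ha, hy⟩

theorem IsFibrant.one (X : SetoidCat.{u}) : (DepSetoid.one X).IsFibrant :=
  fun _ _ h _ => ⟨PUnit.unit, h⟩

theorem IsFibrant.sig {X : SetoidCat.{u}} {Y : DepSetoid X} {Z : DepSetoid Y.total}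
    (hY : Y.IsFibrant) (hZ : Z.IsFibrant) : (DepSetoid.sig Y Z).IsFibrant := fun x₁ x₂ h w₁ => by
  obtain ⟨y, hy⟩ := hY x₁ x₂ h w₁.1
  obtain ⟨z, hz⟩ := hZ ⟨x₁, w₁.1⟩ ⟨x₂, y⟩ hy w₁.2
  exact ⟨⟨y, z⟩, hz⟩

end DepSetoid

/-- The CwF of setoids: types over a setoid are dependent setoids. -/
def SetoidCwF₀ : CwF.{u + 1, u, u + 1, u} where
  Ctx := SetoidCat.{u}
  empty := ⟨PUnit, ⊤⟩
  emptyIsTerminal := IsTerminal.ofUniqueHom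
    (fun _ => SetoidHom.mk (fun _ => PUnit.unit) (fun _ => trivial)) (fun _ _ => rfl)
  Ty := DepSetoid
  Tm _ Y := Y.Section
  tySub := DepSetoid.sub
  tySub_id := DepSetoid.sub_id
  tySub_comp := DepSetoid.sub_comp
  tmSub f _ s := DepSetoid.Section.sub f s
  tmSub_id _ := DepSetoid.Section.heq (DepSetoid.sub_id _) HEq.rfl
  tmSub_comp _ _ _ _ := DepSetoid.Section.heq (DepSetoid.sub_comp _ _ _) HEq.rfl
  ext _ Y := Y.total
  p := DepSetoid.proj
  q := DepSetoid.gen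
  lift := DepSetoid.lift
  lift_p _ _ _ := rfl
  lift_q _ _ _ := DepSetoid.Section.heq (DepSetoid.sub_comp _ _ _).symm HEq.rfl
  lift_uniq := DepSetoid.lift_uniq

namespace DepSetoid

/-- The morphism `X ⟶ X.Y` given by a section. -/
def Section.graph {X : SetoidCat.{u}} {Y : DepSetoid X} (s : Y.Section) : X ⟶ Y.total :=
  ⟨fun x => ⟨x, s.toFun x⟩, fun h => s.map_rel h⟩

/-- The morphism `A.Y[f] ⟶ X.Y` over `f`. -/
def upMap {A X : SetoidCat.{u}} (f : A ⟶ X) (Y : DepSetoid X) : (sub f Y).total ⟶ Y.total :=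
  ⟨fun z => ⟨f.toFun z.1, z.2⟩, fun h => h.2⟩

theorem inst_eq {X : SetoidCat.{u}} {Y : DepSetoid X} (s : Y.Section) :
    SetoidCwF₀.inst (A := Y) s = s.graph := by
  refine SetoidHom.ext (funext fun x => ?_)
  have h := Section.cast_toFun (sub_id Y).symm
    (congrArg Section (sub_id Y).symm) s
  exact congrArg (Sigma.mk x) (congrFun (eq_of_heq h) x)

theorem up_eq {A X : SetoidCat.{u}} (f : A ⟶ X) (Y : DepSetoid X) :
    SetoidCwF₀.up f Y = upMap f Y := by
  refine SetoidHom.ext (funext fun x => ?_)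
  have h := Section.cast_toFun (sub_comp (proj (sub f Y)) f Y).symm
    (congrArg Section (sub_comp (proj (sub f Y)) f Y).symm) (gen (sub f Y))
  exact congrArg (Sigma.mk (f.toFun x.1)) (congrFun (eq_of_heq h) x)

/-- The section of `sig Y Z` given by a section of `Y` and a section of `Z` over it. -/
def Section.pair {X : SetoidCat.{u}} {Y : DepSetoid X} {Z : DepSetoid Y.total}
    (s : Y.Section) (t : (DepSetoid.sub s.graph Z).Section) : (sig Y Z).Section :=
  ⟨fun x => ⟨s.toFun x, t.toFun x⟩, fun h => (t.map_rel h).2⟩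

theorem Section.pair_bijective {X : SetoidCat.{u}} (Y : DepSetoid X) (Z : DepSetoid Y.total) :
    Function.Bijective (fun c : (s : Y.Section) × (DepSetoid.sub s.graph Z).Section =>
      Section.pair c.1 c.2) := by
  constructor
  · rintro ⟨s, t⟩ ⟨s', t'⟩ h
    have h' := congrArg Section.toFun h
    obtain rfl : s = s' := Section.ext (funext fun x => congrArg Sigma.fst (congrFun h' x))
    obtain rfl : t = t' := Section.ext (funext fun x =>
      eq_of_heq (Sigma.mk.inj (congrFun h' x)).2)
    rfl
  · intro w
    exact ⟨⟨⟨fun x => (w.toFun x).1, fun h => Z.base (w.map_rel h)⟩,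
      ⟨fun x => (w.toFun x).2, fun h => ⟨h, w.map_rel h⟩⟩⟩, rfl⟩

theorem sub_sig {A X : SetoidCat.{u}} (f : A ⟶ X) (Y : DepSetoid X) (Z : DepSetoid Y.total) :
    sub f (sig Y Z) = sig (sub f Y) (sub (upMap f Y) Z) := by
  refine DepSetoid.ext rfl (heq_of_eq ?_)
  funext x₁ x₂ y₁ y₂
  exact propext ⟨fun h => ⟨⟨h.1, Z.base h.2⟩, h.2⟩, fun h => ⟨h.1.1, h.2⟩⟩

theorem Section.pair_sub {A X : SetoidCat.{u}} (f : A ⟶ X) {Y : DepSetoid X}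
    {Z : DepSetoid Y.total} (s : Y.Section) (t : (DepSetoid.sub s.graph Z).Section)
    (t' : (DepSetoid.sub (Section.sub f s).graph (DepSetoid.sub (upMap f Y) Z)).Section)
    (h : HEq t' (Section.sub f t)) :
    HEq (Section.sub f (Section.pair s t)) (Section.pair (Section.sub f s) t') := by
  refine Section.heq (sub_sig f Y Z) (heq_of_eq ?_)
  have e : DepSetoid.sub (Section.sub f s).graph (DepSetoid.sub (upMap f Y) Z) =
      DepSetoid.sub f (DepSetoid.sub s.graph Z) := by
    rw [← sub_comp, ← sub_comp]; rfl
  have := eq_of_heq (Section.toFun_heq e h)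
  funext x
  exact congrArg (Sigma.mk _) (congrFun this x).symm

end DepSetoid

/-- The `Σ`-CwF of setoids. -/
def SetoidCwF : SigmaCwF.{u + 1, u, u + 1, u} where
  toCwF := SetoidCwF₀
  one := DepSetoid.one
  one_sub f := by
    refine DepSetoid.ext rfl (heq_of_eq ?_)
    funext x₁ x₂ y₁ y₂
    exact propext ⟨fun h => h.1, fun h => ⟨h, f.map_rel h⟩⟩
  oneUnique X :=
    { default := ⟨fun _ => PUnit.unit, fun h => h⟩
      uniq := fun _ => rfl }
  sig := DepSetoid.sig
  sig_sub f Y Z := (DepSetoid.sub_sig f Y Z).trans (congrArg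
    (fun g => DepSetoid.sig (DepSetoid.sub f Y) (DepSetoid.sub g Z)) (DepSetoid.up_eq f Y).symm)
  pair {_ _ B} s t := DepSetoid.Section.pair s
    (cast (congrArg (fun g => (DepSetoid.sub g B).Section) (DepSetoid.inst_eq s)) t)
  pair_bijective Y Z := by
    refine (DepSetoid.Section.pair_bijective Y Z).comp (Equiv.bijective
      (Equiv.sigmaCongrRight fun s => Equiv.cast
        (congrArg (fun g => (DepSetoid.sub g Z).Section) (DepSetoid.inst_eq s))))
  pair_sub f Y Z s t t' h := by
    have e : ∀ (g : _ ⟶ _) (_ : g = DepSetoid.upMap f Y)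
        (i : _ ⟶ _) (hi : i = (DepSetoid.Section.sub f s).graph)
        (t' : (DepSetoid.sub i (DepSetoid.sub g Z)).Section)
        (_ : HEq t' (DepSetoid.Section.sub f t)),
        HEq (DepSetoid.Section.sub f (DepSetoid.Section.pair s (cast (congrArg
          (fun g => (DepSetoid.sub g Z).Section) (DepSetoid.inst_eq s)) t)))
          (DepSetoid.Section.pair (DepSetoid.Section.sub f s) (cast (congrArg
          (fun i => (DepSetoid.sub i (DepSetoid.sub g Z)).Section) hi) t')) := by
      rintro _ rfl _ rfl t' h
      refine DepSetoid.Section.pair_sub f s _ _ ?_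
      refine h.trans (SetoidCwF₀.tmSub_congr f ?_ (cast_heq _ _).symm)
      exact congrArg (fun g => DepSetoid.sub g Z) (DepSetoid.inst_eq s)
    exact e _ (DepSetoid.up_eq f Y) _ (DepSetoid.inst_eq _) t' h

/-! ## The sub-CwF of fibrant types -/

/-- A class of types closed under substitution and the type formers. -/
structure SigmaCwF.TypeClass (C : SigmaCwF.{u₁, v₁, w₁, t₁}) where
  mem : {Γ : C.Ctx} → C.Ty Γ → Prop
  sub_mem : ∀ {Δ Γ : C.Ctx} (σ : Δ ⟶ Γ) {A : C.Ty Γ}, mem A → mem (C.tySub σ A)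
  one_mem : ∀ Γ : C.Ctx, mem (C.one Γ)
  sig_mem : ∀ {Γ : C.Ctx} {A : C.Ty Γ} {B : C.Ty (C.ext Γ A)}, mem A → mem B → mem (C.sig A B)

/-- The sub-CwF, over the same base category, whose types are restricted to a class. -/
def SigmaCwF.restrict₀ (C : SigmaCwF.{u₁, v₁, w₁, t₁}) (P : C.TypeClass) :
    CwF.{u₁, v₁, w₁, t₁} where
  Ctx := C.Ctx
  empty := C.empty
  emptyIsTerminal := C.emptyIsTerminal
  Ty Γ := {A : C.Ty Γ // P.mem A}
  Tm Γ A := C.Tm Γ A.1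
  tySub σ A := ⟨C.tySub σ A.1, P.sub_mem σ A.2⟩
  tySub_id A := Subtype.ext (C.tySub_id A.1)
  tySub_comp τ σ A := Subtype.ext (C.tySub_comp τ σ A.1)
  tmSub σ _ a := C.tmSub σ a
  tmSub_id a := C.tmSub_id a
  tmSub_comp τ σ _ a := C.tmSub_comp τ σ a
  ext Γ A := C.ext Γ A.1
  p A := C.p A.1
  q A := C.q A.1
  lift σ A a := C.lift σ A.1 a
  lift_p σ A a := C.lift_p σ A.1 a
  lift_q σ A a := C.lift_q σ A.1 a
  lift_uniq σ A a τ h h' := C.lift_uniq σ A.1 a τ h h'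

/-- The sub-`Σ`-CwF, over the same base category, whose types are restricted to a class. -/
def SigmaCwF.restrict (C : SigmaCwF.{u₁, v₁, w₁, t₁}) (P : C.TypeClass) :
    SigmaCwF.{u₁, v₁, w₁, t₁} where
  toCwF := C.restrict₀ P
  one Γ := ⟨C.one Γ, P.one_mem Γ⟩
  one_sub σ := Subtype.ext (C.one_sub σ)
  oneUnique Γ := C.oneUnique Γ
  sig A B := ⟨C.sig A.1 B.1, P.sig_mem A.2 B.2⟩
  sig_sub σ A B := Subtype.ext (C.sig_sub σ A.1 B.1)
  pair {_ A B} a b := C.pair (A := A.1) (B := B.1) a b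
  pair_bijective A B := C.pair_bijective A.1 B.1
  pair_sub σ A B a b b' h := C.pair_sub σ (A := A.1) (B := B.1) a b b' h

/-- Fibrant dependent setoids. -/
def fibrantClass : SetoidCwF.{u}.TypeClass where
  mem Y := DepSetoid.IsFibrant Y
  sub_mem f _ h := DepSetoid.IsFibrant.sub f h
  one_mem X := DepSetoid.IsFibrant.one X
  sig_mem h h' := DepSetoid.IsFibrant.sig h h'

/-- The sub-`Σ`-CwF of setoids whose types are the fibrant dependent setoids. -/
def SetoidFibCwF : SigmaCwF.{u + 1, u, u + 1, u} :=
  SetoidCwF.restrict fibrantClass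

/-! ## Underlying sets and quotients of setoids -/

/-- The functor sending a setoid to its underlying set. -/
def setoidForget : SetoidCat.{u} ⥤ Type u where
  obj X := X.carrier
  map f := ↾f.toFun

/-- The functor sending a setoid to its quotient set. -/
def setoidQuotient : SetoidCat.{u} ⥤ Type u where
  obj X := Quotient X.str
  map f := ↾Quotient.map f.toFun (fun _ _ h => f.map_rel h)
  map_id X := by
    ext x; induction x using Quotient.inductionOn; rfl
  map_comp f g := by
    ext x; induction x using Quotient.inductionOn; rfl

/-- The quotient maps `q : U ⟶ Q`. -/
def quotientMap : setoidForget.{u} ⟶ setoidQuotient.{u} where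
  app X := ↾Quotient.mk X.str

/-- The action of the underlying set functor on types and context extensions. -/
def forgetData : SigmaCwFHomData SetoidCwF.{u} SetCwF.{u} where
  functor := setoidForget
  ty Y := Y.fam
  cmp Y := 𝟙 ((x : _) × DepSetoid.fam Y x)
  cmp_p _ := rfl

/-- The action of the quotient functor on types and context extensions: a fibrant dependent
setoid `Y` over `X` is sent to the family over `X/∼` whose fibre at `ξ` consists of the classes
of pairs `(x, y)` with `[x] = ξ`. -/
def quotientData : SigmaCwFHomData SetoidFibCwF.{u} SetCwF.{u} where
  functor := setoidQuotient
  ty Y := fun ξ => {b : setoidQuotient.obj (DepSetoid.total Y.1) //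
    setoidQuotient.map (DepSetoid.proj Y.1) b = ξ}
  cmp Y := ↾fun b => ⟨setoidQuotient.map (DepSetoid.proj Y.1) b, b, rfl⟩
  cmp_p _ := rfl

theorem forgetData_isHom : forgetData.{u}.IsHom where
  terminal := ⟨Types.isTerminalPUnit⟩
  isIso_cmp Y := inferInstanceAs (IsIso (𝟙 ((x : _) × DepSetoid.fam Y x)))
  subst f Y := by
    have h := SetCwF.{u}.isPullback_up (setoidForget.map f) (DepSetoid.fam Y)
    have e : SetoidCwF₀.up f Y = DepSetoid.upMap f Y := DepSetoid.up_eq f Y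
    change IsPullback (setoidForget.map (SetoidCwF₀.up f Y)) _ _ _
    rw [e]
    exact h

/-- The `Σ`-CwF morphism from setoids to sets sending a setoid to its underlying set. -/
def forgetHom : SigmaCwFHom SetoidCwF.{u} SetCwF.{u} :=
  ⟨forgetData, forgetData_isHom⟩

/-! ## Models -/

/-- A model of `T` is a morphism of `Σ`-CwFs from `T` to sets. -/
abbrev Model (T : SigmaCwF.{u₁, v₁, w₁, t₁}) :=
  SigmaCwFHom T SetCwF.{u}

namespace Model

variable {T : SigmaCwF.{u₁, v₁, w₁, t₁}}

/-- The functor underlying a model. -/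
abbrev functor (M : Model.{u} T) : T.Ctx ⥤ Type u :=
  M.toData.functor

/-- The set `M_X` of elements of the closed sort `X`. -/
abbrev elem (M : Model.{u} T) (X : T.Ctx) : Type u :=
  M.functor.obj X

/-- The set `M_Y(x)` of elements of the dependent sort `Y`. -/
abbrev depElem (M : Model.{u} T) {X : T.Ctx} (Y : T.Ty X) (x : M.elem X) : Type u :=
  M.toData.ty Y x

/-- The bijection between `M_{X.Y}` and the set of pairs `(x, y)`. -/
noncomputable def extEquiv (M : Model.{u} T) {X : T.Ctx} (Y : T.Ty X) :
    M.elem (T.ext X Y) ≃ (x : M.elem X) × M.depElem Y x :=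
  have := M.isHom.isIso_cmp Y
  Iso.toEquiv (X := M.functor.obj (T.ext X Y)) (asIso (M.toData.cmp Y))

theorem extEquiv_fst (M : Model.{u} T) {X : T.Ctx} (Y : T.Ty X) (z : M.elem (T.ext X Y)) :
    (M.extEquiv Y z).1 = M.functor.map (T.p Y) z :=
  congrArg (fun f : M.functor.obj (T.ext X Y) ⟶ M.functor.obj X => f z) (M.toData.cmp_p Y)

/-- A morphism of models is a natural transformation. -/
abbrev Hom (M N : Model.{u} T) :=
  M.functor ⟶ N.functor

namespace Hom

variable {M N : Model.{u} T}

theorem extEquiv_app_fst (F : Hom M N) {X : T.Ctx} (Y : T.Ty X) (x : M.elem X)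
    (y : M.depElem Y x) :
    (N.extEquiv Y (F.app (T.ext X Y) ((M.extEquiv Y).symm ⟨x, y⟩))).1 = F.app X x := by
  rw [N.extEquiv_fst, ← NatTrans.naturality_apply, ← M.extEquiv_fst, Equiv.apply_symm_apply]

/-- The action `F_Y : M_Y(x) → N_Y(F_X(x))` on elements of a dependent sort. -/
noncomputable def depApp (F : Hom M N) {X : T.Ctx} (Y : T.Ty X) (x : M.elem X)
    (y : M.depElem Y x) : N.depElem Y (F.app X x) :=
  cast (congrArg (N.depElem Y) (F.extEquiv_app_fst Y x y))
    (N.extEquiv Y (F.app (T.ext X Y) ((M.extEquiv Y).symm ⟨x, y⟩))).2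

/-- `F_{X.Y}` sends `(x, y)` to `(F_X(x), F_Y(y))`. -/
theorem extEquiv_app (F : Hom M N) {X : T.Ctx} (Y : T.Ty X) (x : M.elem X)
    (y : M.depElem Y x) :
    N.extEquiv Y (F.app (T.ext X Y) ((M.extEquiv Y).symm ⟨x, y⟩)) =
      ⟨F.app X x, F.depApp Y x y⟩ :=
  Sigma.ext (F.extEquiv_app_fst Y x y) (cast_heq _ _).symm

/-- A non-split trivial fibration: for every dependent sort `X ⊢ Y` and every `x`, every
element of `N_Y(F_X(x))` merely has a preimage in `M_Y(x)`. -/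
def IsNonSplitTrivialFibration (F : Hom M N) : Prop :=
  ∀ (X : T.Ctx) (Y : T.Ty X) (x : M.elem X), Function.Surjective (F.depApp Y x)

/-- The kernel of a morphism at a closed sort. -/
def kerRel (F : Hom M N) (X : T.Ctx) (x₁ x₂ : M.elem X) : Prop :=
  F.app X x₁ = F.app X x₂

/-- The kernel of a morphism at a dependent sort, relating elements over `x₁` and `x₂` whose
images are the same element (over the same element). -/
def kerDepRel (F : Hom M N) {X : T.Ctx} (Y : T.Ty X) (x₁ x₂ : M.elem X)
    (y₁ : M.depElem Y x₁) (y₂ : M.depElem Y x₂) : Prop :=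
  (⟨F.app X x₁, F.depApp Y x₁ y₁⟩ : (x : N.elem X) × N.depElem Y x) =
    ⟨F.app X x₂, F.depApp Y x₂ y₂⟩

end Hom

end Model

/-! ## Congruences -/

/-- A congruence over a model `M` is a morphism of `Σ`-CwFs from `T` to setoids whose
composite with the underlying set morphism is `M`. -/
structure Model.Congruence {T : SigmaCwF.{u₁, v₁, w₁, t₁}} (M : Model.{u} T) where
  hom : SigmaCwFHom T SetoidCwF.{u}
  comp_eq : hom.comp forgetHom = M

namespace Model.Congruence

variable {T : SigmaCwF.{u₁, v₁, w₁, t₁}} {M : Model.{u} T}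

/-- The equivalence relation on `M_X`. -/
def rel : {M : Model.{u} T} → (C : Congruence M) → (X : T.Ctx) → Setoid (M.elem X)
  | _, ⟨hom, rfl⟩, X => (hom.toData.functor.obj X).str

/-- The dependent equivalence relation on `M_Y`. -/
def depRel : {M : Model.{u} T} → (C : Congruence M) → {X : T.Ctx} → (Y : T.Ty X) →
    (x₁ x₂ : M.elem X) → M.depElem Y x₁ → M.depElem Y x₂ → Prop
  | _, ⟨hom, rfl⟩, _, Y => (hom.toData.ty Y).rel

/-- Fibrancy of a congruence. -/
def IsFibrant (C : Congruence M) : Prop :=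
  ∀ (X : T.Ctx) (Y : T.Ty X), DepSetoid.IsFibrant (C.hom.toData.ty Y)

/-- The factorization of a fibrant congruence through the fibrant setoids. -/
def fibHom (C : Congruence M) (hC : C.IsFibrant) : SigmaCwFHom T SetoidFibCwF.{u} where
  toData :=
    { functor := C.hom.toData.functor
      ty := fun Y => ⟨C.hom.toData.ty Y, hC _ Y⟩
      cmp := fun Y => C.hom.toData.cmp Y
      cmp_p := fun Y => C.hom.toData.cmp_p Y }
  isHom :=
    { terminal := C.hom.isHom.terminal
      isIso_cmp := fun Y => C.hom.isHom.isIso_cmp Y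
      subst := fun σ Y => C.hom.isHom.subst σ Y }

/-- The congruence is contained in the kernel of `F`, on closed and on dependent sorts. -/
def LeKer (C : Congruence M) {N : Model.{u} T} (F : Model.Hom M N) : Prop :=
  (∀ (X : T.Ctx) (x₁ x₂ : M.elem X), C.rel X x₁ x₂ → F.kerRel X x₁ x₂) ∧
  ∀ (X : T.Ctx) (Y : T.Ty X) (x₁ x₂ : M.elem X) (y₁ : M.depElem Y x₁) (y₂ : M.depElem Y x₂),
    C.depRel Y x₁ x₂ y₁ y₂ → F.kerDepRel Y x₁ x₂ y₁ y₂

/-- `q : M ⟶ N` is a quotient of the congruence: the congruence is contained in the kernel of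
`q`, and `q` is universal among such morphisms. -/
def IsQuotient (C : Congruence M) {N : Model.{u} T} (q : Model.Hom M N) : Prop :=
  C.LeKer q ∧ ∀ (N' : Model.{u} T) (F : Model.Hom M N'), C.LeKer F →
    ∃! F' : Model.Hom N N', (q ≫ F' : M.functor ⟶ N'.functor) = F

/-- `q : M ⟶ N` is a quotient map of sets on every sort: for closed sorts, `q_X` is surjective
and identifies exactly the related elements of `M_X`; for dependent sorts, `q_Y` maps `M_Y(x)`
onto `N_Y(q_X(x))` and identifies exactly the related elements. -/
def IsSortwiseQuotient (C : Congruence M) {N : Model.{u} T} (q : Model.Hom M N) : Prop :=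
  (∀ X : T.Ctx, Function.Surjective (q.app X) ∧
    ∀ x₁ x₂ : M.elem X, q.kerRel X x₁ x₂ ↔ C.rel X x₁ x₂) ∧
  ∀ (X : T.Ctx) (Y : T.Ty X), (∀ x : M.elem X, Function.Surjective (q.depApp Y x)) ∧
    ∀ (x₁ x₂ : M.elem X) (y₁ : M.depElem Y x₁) (y₂ : M.depElem Y x₂),
      q.kerDepRel Y x₁ x₂ y₁ y₂ ↔ C.depRel Y x₁ x₂ y₁ y₂

/-- The model `Q ∘ C`, given that the quotient functor is a morphism of `Σ`-CwFs. -/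
def quotient (C : Congruence M) (hC : C.IsFibrant) (hQ : quotientData.{u}.IsHom) :
    Model.{u} T :=
  (C.fibHom hC).comp ⟨quotientData, hQ⟩

/-- The quotient inclusion, whose components are the quotient maps of the setoids `C_X`. -/
def quotientInclusion : {M : Model.{u} T} → (C : Congruence M) → (hC : C.IsFibrant) →
    (hQ : quotientData.{u}.IsHom) → Model.Hom M (C.quotient hC hQ)
  | _, ⟨hom, rfl⟩, _, _ => Functor.whiskerLeft hom.toData.functor quotientMap

end Model.Congruence

/-! The fibre of `Q(Y)` over `ξ` is by definition the fibre of `Q(X.Y) → Q(X)`, so context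
extensions are preserved almost by construction. The real content is substitution. For `f : A ⟶ X`,
the comparison map from `Q(A.Y[f])` to the pullback of `Q(X.Y)` along `Q(f)` is always injective,
because a relation in `Y[f]` is a relation in `A` together with one in `Y`. It need not be
surjective: a point of the pullback is a class `[(x, y)]` and a class `[a]` with `x ∼ f(a)`, and `y`
may have no related element over `f(a)`. Fibrancy supplies exactly this element. This is
`quotientData_isHom`, and it makes `Q ∘ C` a model for every fibrant congruence `C`.

The quotient inclusion sends `y` over `x` to the class of `(x, y)` in the total setoid
(`quotientInclusion_depApp`). Its kernel is then the given relation on every sort, since quotients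
of sets by equivalence relations are effective. Surjectivity on closed sorts is immediate. On
dependent sorts it is a second use of fibrancy, now over a fixed `x`: an element over `[x]` is
represented by a pair whose first component is only related to `x`, and its second component has to
be moved over `x` (`quotientInclusion_isNonSplitTrivialFibration`).

The universal property follows formally from the sortwise description
(`IsSortwiseQuotient.isQuotient`): a morphism of models is a natural transformation, so it descends
objectwise along surjections, and naturality is inherited. -/

/-! ### The quotient functor as a morphism of Σ-CwFs -/

theorem quotientData_isHom : quotientData.{u}.IsHom where
  terminal := by
    have : Unique (setoidQuotient.obj SetoidFibCwF.{u}.empty) :=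
      { default := Quotient.mk _ PUnit.unit
        uniq := fun b => Quotient.inductionOn b fun _ => rfl }
    exact ⟨(Types.isTerminalEquivUnique _).symm this⟩
  isIso_cmp Y := by
    -- A set mapping to `Q(X)` is the disjoint union of its fibres. The class `b` is recovered from
    -- the second component, and the first is determined by it.
    refine (isIso_iff_bijective _).2 ⟨fun b b' h => ?_, ?_⟩
    · exact congrArg (fun z : (ξ : _) × quotientData.ty Y ξ => z.2.1) h
    · rintro ⟨_, b, rfl⟩
      exact ⟨b, rfl⟩
  subst {A X} f Y := by
    -- `up` contains a cast along `tySub_comp`. Replacing it by the cast-free `upMap` lets its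
    -- action on representatives compute, which the three pullback conditions below rely on.
    have e : SetoidFibCwF.up f Y = DepSetoid.upMap f Y.1 := DepSetoid.up_eq f Y.1
    change IsPullback (setoidQuotient.map (SetoidFibCwF.up f Y)) _ _ _
    rw [e]
    refine (Types.isPullback_iff _ _ _ _).2 ⟨?_, ?_, ?_⟩
    · ext b
      induction b using Quotient.inductionOn
      rfl
    · intro b b' h
      induction b using Quotient.inductionOn with | _ z
      induction b' using Quotient.inductionOn with | _ z'
      -- Relatedness in the total setoid of `Y[f]` is the conjunction of relatedness in `A` (equal
      -- projections) and in `Y` (equal images in `Q(X.Y)`).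
      exact Quotient.sound ⟨Quotient.exact h.2, Quotient.exact h.1⟩
    · intro b α h
      induction b using Quotient.inductionOn with | _ z
      induction α using Quotient.inductionOn with | _ a
      -- Compatibility of the two classes gives only `z.1 ∼ f(a)`. Fibrancy moves `z.2` to a related
      -- `y` over `f(a)`, so that `(a, y)` is a point of `A.Y[f]`.
      obtain ⟨y, hy⟩ := Y.2 z.1 (f.toFun a) (Quotient.exact h) z.2
      exact ⟨Quotient.mk _ ⟨a, y⟩, Quotient.sound (Y.1.symm hy), rfl⟩

/-! ### The quotient inclusion: kernel, surjectivity and universal property -/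

namespace Model.Congruence

variable {T : SigmaCwF.{u₁, v₁, w₁, t₁}}

/-- The quotient inclusion sends `y` over `x` to the class of `(x, y)`. -/
theorem quotientInclusion_depApp (hom : SigmaCwFHom T SetoidCwF.{u})
    (hC : (⟨hom, rfl⟩ : Congruence (hom.comp forgetHom)).IsFibrant)
    (hQ : quotientData.{u}.IsHom) {X : T.Ctx} (Y : T.Ty X)
    (x : (hom.toData.functor.obj X).carrier) (y : (hom.toData.ty Y).fam x) :
    (quotientInclusion ⟨hom, rfl⟩ hC hQ).depApp Y x y =
      (⟨Quotient.mk (DepSetoid.total (hom.toData.ty Y)).str ⟨x, y⟩, rfl⟩ :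
        quotientData.ty ⟨hom.toData.ty Y, hC X Y⟩ (Quotient.mk _ x)) := by
  let C : Congruence (hom.comp forgetHom) := ⟨hom, rfl⟩
  let M : Model.{u} T := hom.comp forgetHom
  -- `depApp` is defined with a cast between fibres. The comparison is therefore made between pairs
  -- in the total space, where no cast occurs, and second components are extracted at the end.
  have h := (C.quotientInclusion hC hQ).extEquiv_app Y x y
  -- The comparison map of the underlying set morphism is an identity, so the bijection `M.extEquiv
  -- Y` is the function underlying `hom.toData.cmp Y`.
  have hz : (hom.toData.cmp Y).toFun ((M.extEquiv Y).symm ⟨x, y⟩) = ⟨x, y⟩ :=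
    (M.extEquiv Y).apply_symm_apply ⟨x, y⟩
  refine eq_of_heq (Sigma.mk.inj (h.symm.trans ?_)).2
  exact congrArg (fun z : (DepSetoid.total (hom.toData.ty Y)).carrier =>
    quotientData.cmp ⟨hom.toData.ty Y, hC X Y⟩ (Quotient.mk _ z)) hz

theorem quotientInclusion_kerRel {M : Model.{u} T} (C : Congruence M) (hC : C.IsFibrant)
    (hQ : quotientData.{u}.IsHom) (X : T.Ctx) (x₁ x₂ : M.elem X) :
    (C.quotientInclusion hC hQ).kerRel X x₁ x₂ ↔ C.rel X x₁ x₂ := by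
  -- Eliminating `comp_eq` makes `M` literally the underlying model of `hom`, so that the relation
  -- and the inclusion unfold to those of the setoid.
  obtain ⟨hom, rfl⟩ := C
  exact Quotient.eq (r := (hom.toData.functor.obj X).str)

/-- Both images are classes in the same set `Q(X.Y)`, by `quotientInclusion_depApp`. The dependent
relation is the relation of the total setoid, so effectiveness of that one quotient gives the claim,
including the relation between the base points. -/
theorem quotientInclusion_kerDepRel {M : Model.{u} T} (C : Congruence M) (hC : C.IsFibrant)
    (hQ : quotientData.{u}.IsHom) {X : T.Ctx} (Y : T.Ty X) (x₁ x₂ : M.elem X)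
    (y₁ : M.depElem Y x₁) (y₂ : M.depElem Y x₂) :
    (C.quotientInclusion hC hQ).kerDepRel Y x₁ x₂ y₁ y₂ ↔ C.depRel Y x₁ x₂ y₁ y₂ := by
  obtain ⟨hom, rfl⟩ := C
  unfold Hom.kerDepRel
  rw [quotientInclusion_depApp hom hC hQ Y x₁ y₁, quotientInclusion_depApp hom hC hQ Y x₂ y₂]
  constructor
  · intro h
    exact Quotient.exact (congrArg
      (fun z : (ξ : _) × quotientData.ty ⟨hom.toData.ty Y, hC X Y⟩ ξ => z.2.1) h)
  · intro h
    -- `cmp` sends the class of `(x, y)` to the pair of `[x]` and that class, so one equality in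
    -- `Q(X.Y)` yields equality of both components.
    exact congrArg (quotientData.cmp ⟨hom.toData.ty Y, hC X Y⟩)
      (Quotient.sound (s := (DepSetoid.total (hom.toData.ty Y)).str)
        (a := ⟨x₁, y₁⟩) (b := ⟨x₂, y₂⟩) h)

theorem quotientInclusion_app_surjective {M : Model.{u} T} (C : Congruence M)
    (hC : C.IsFibrant) (hQ : quotientData.{u}.IsHom) (X : T.Ctx) :
    Function.Surjective ((C.quotientInclusion hC hQ).app X) := by
  obtain ⟨hom, rfl⟩ := C
  exact Quotient.mk_surjective (s := (hom.toData.functor.obj X).str)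

theorem quotientInclusion_isNonSplitTrivialFibration {M : Model.{u} T} (C : Congruence M)
    (hC : C.IsFibrant) (hQ : quotientData.{u}.IsHom) :
    (C.quotientInclusion hC hQ).IsNonSplitTrivialFibration := by
  obtain ⟨hom, rfl⟩ := C
  rintro X Y x ⟨b, hb⟩
  induction b using Quotient.inductionOn with | _ z
  -- The representative `z` lies over some `z.1 ∼ x`, not over `x` itself. Fibrancy replaces it by
  -- `(x, y)` in the same class. The lift is only asserted to exist, hence a non-split fibration.
  obtain ⟨y, hy⟩ := hC X Y z.1 x (Quotient.exact hb) z.2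
  refine ⟨y, (quotientInclusion_depApp hom hC hQ Y x y).trans (Subtype.ext ?_)⟩
  exact Quotient.sound ((hom.toData.ty Y).symm hy)

theorem quotientInclusion_isSortwiseQuotient {M : Model.{u} T} (C : Congruence M)
    (hC : C.IsFibrant) (hQ : quotientData.{u}.IsHom) :
    C.IsSortwiseQuotient (C.quotientInclusion hC hQ) :=
  ⟨fun X => ⟨C.quotientInclusion_app_surjective hC hQ X, C.quotientInclusion_kerRel hC hQ X⟩,
    fun X Y => ⟨C.quotientInclusion_isNonSplitTrivialFibration hC hQ X Y,
      C.quotientInclusion_kerDepRel hC hQ Y⟩⟩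

/-- A sortwise quotient map is a quotient. -/
theorem IsSortwiseQuotient.isQuotient {M : Model.{u} T} {C : Congruence M} {N : Model.{u} T}
    {q : Hom M N} (hq : C.IsSortwiseQuotient q) : C.IsQuotient q := by
  refine ⟨⟨fun X x₁ x₂ => ((hq.1 X).2 x₁ x₂).2,
    fun X Y x₁ x₂ y₁ y₂ => ((hq.2 X Y).2 x₁ x₂ y₁ y₂).2⟩, fun N' F hF => ?_⟩
  have hs := fun X => (hq.1 X).1
  have hF' : ∀ X x₁ x₂, q.app X x₁ = q.app X x₂ → F.app X x₁ = F.app X x₂ :=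
    fun X x₁ x₂ h => hF.1 X x₁ x₂ (((hq.1 X).2 x₁ x₂).1 h)
  -- The value is independent of the chosen preimage by `hF'`. Dependent sorts need no separate
  -- treatment: their elements are covered by the objects `X.Y`, and a morphism of models is
  -- determined by its components at objects.
  let g : ∀ X, N.elem X → N'.elem X := fun X ξ => F.app X (Function.surjInv (hs X) ξ)
  have hg : ∀ X x, g X (q.app X x) = F.app X x :=
    fun X x => hF' X _ _ (Function.surjInv_eq (hs X) _)
  refine ⟨{ app := fun X => ↾(g X), naturality := fun X X' f => ?_ }, ?_, fun G hG => ?_⟩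
  · ext ξ
    -- Every `ξ` is of the form `q(x)`, where `hg` turns `g` into `F`; naturality of `g` reduces to
    -- that of `q` and `F`.
    obtain ⟨x, rfl⟩ := hs X ξ
    change g X' (N.functor.map f (q.app X x)) = N'.functor.map f (g X (q.app X x))
    rw [hg, ← NatTrans.naturality_apply, hg, NatTrans.naturality_apply]
  · ext X x
    exact hg X x
  · ext X ξ
    obtain ⟨x, rfl⟩ := hs X ξ
    subst hG
    exact (hg X x).symm

end Model.Congruence

/-- The proof `hQ` that `Q` is a morphism is the outer witness because the model `Q ∘ C`, and hence
the inclusion, can only be formed from it. -/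
theorem mainTheorem3 :
    ∃ hQ : quotientData.{u}.IsHom,
      ∀ (T : SigmaCwF.{u₁, v₁, w₁, t₁}) (M : Model.{u} T) (C : Model.Congruence M)
        (hC : C.IsFibrant),
        C.IsQuotient (C.quotientInclusion hC hQ) ∧
        C.IsSortwiseQuotient (C.quotientInclusion hC hQ) ∧
        (C.quotientInclusion hC hQ).IsNonSplitTrivialFibration :=
  ⟨quotientData_isHom, fun _ _ C hC =>
    have h := C.quotientInclusion_isSortwiseQuotient hC quotientData_isHom
    ⟨h.isQuotient, h, C.quotientInclusion_isNonSplitTrivialFibration hC quotientData_isHom⟩⟩
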